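/- **Setting.** Fix an integer $K\ge 2$ and constants $A,B,\tau>0$ with $KA\le B<1$ and $\tau\le (1-B)/K$. Let $\mathcal A,\mathcal W$ be measurable spaces. For every $u\in\mathcal A$ let $S_1(u),\dots,S_K(u)$ be similarities of $[0,1]$ into itself with scaling ratios $a(i,u)$, measurable in $u$, such that $A\le a(i,u)$ for all $i$, $\sum_i a(i,u)\le B$, and $\mathrm{dist}(S_i(u)[0,1],S_j(u)[0,1])\ge\tau$ for $i\ne j$. For every $v\in\mathcal W$ let $(p(1,v),\dots,p(K,v))$ be a probability vector, measurable in $v$. Put $\Lambda=\mathcal A\times\mathcal W$ and, for $\lambda=(u,v)$, $a(i,\lambda)=a(i,u)$, $p(i,\lambda)=p(i,v)$. Let $\mathbb P$ be a probability measure on $\Lambda$ (not necessarily a product) such that for some $t>0$, $\mathbb E(p(i,\lambda)^{-t})<\infty$ for $i=1,\dots,K$ (with $0^{-t}=\infty$). For $\boldsymbol\lambda=(\lambda_n)_{n\ge1}\in\Lambda^{\mathbb N}$ put $I_{i_1\dots i_n}(\boldsymbol\lambda)=S_{i_1}(\lambda_1)\circ\cdots\circ S_{i_n}(\lambda_n)[0,1]$,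 and let $\mu_{\boldsymbol\lambda}$ be the Borel probability measure on $[0,1]$ with $\mu_{\boldsymbol\lambda}(I_{i_1\dots i_n}(\boldsymbol\lambda))=p(i_1,\lambda_1)\cdots p(i_n,\lambda_n)$ for all $n$ and $i_1,\dots,i_n$. The sequence $\boldsymbol\lambda$ is chosen according to $\mathbb P^{\mathbb N}$. For $\theta\ge0$ let $m(\theta,\lambda)$ (respectively $m'(\theta,\lambda)$) be the least index $j\in\{1,\dots,K\}$ at which $a(j,\lambda)^\theta/p(j,\lambda)$ attains its maximum (respectively minimum) over $j$, and set $$G(\theta)=\frac{\mathbb E\log p(m(\theta,\lambda),\lambda)}{\mathbb E\log a(m(\theta,\lambda),\lambda)},\qquad G'(\theta)=\frac{\mathbb E\log p(m'(\theta,\lambda),\lambda)}{\mathbb E\log a(m'(\theta,\lambda),\lambda)}.$$ A *dimension function* is a map $\Phi:(0,1)\to[0,\infty)$ such that $t^{1+\Phi(t)}$ decreases to $0$ as $t$ decreases to $0$ and such that there are $T,C>0$ with $(2t)^{1+\Phi(2t)}\le C\,t^{1+\Phi(t)}$ for $0<t<T$. It is *large* if, for small $t$, $\Phi(t)=H(t)\,\log|\log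 t|/|\log t|$ with $H(t)\to\infty$ as $t\to0$. For a Borel probability measure $\mu$ on $[0,1]$, with open balls $B(x,R)$ in $[0,1]$, the *upper $\Phi$-dimension* $\overline{\dim}_\Phi\mu$ is the infimum of all $d\in\mathbb R$ for which there are $C_1,C_2>0$ such that $$\frac{\mu(B(x,R))}{\mu(B(x,r))}\le C_2\Big(\frac Rr\Big)^d\quad\text{for all } 0<r<R^{1+\Phi(R)}\le R\le C_1\text{ and all }x\in\operatorname{supp}\mu,$$ and the *lower $\Phi$-dimension* $\underline{\dim}_\Phi\mu$ is the supremum of all $d\in\mathbb R$ for which there are $C_1,C_2>0$ such that the reverse inequality $\ge$ holds for all such $r,R,x$ (here $C_1<1$, so that $\Phi(R)$ is defined). **Theorem.** For every large dimension function $\Phi$, almost surely $$\overline{\dim}_\Phi\mu_{\boldsymbol\lambda}=\sup_{\theta\ge0}G(\theta)\qquad\text{and}\qquad\underline{\dim}_\Phi\mu_{\boldsymbol\lambda}=\inf_{\theta\ge0}G'(\theta).$$ -/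

import Mathlib

open MeasureTheory Filter Topology Set

noncomputable section

namespace RandomMoran

/-! ### Dimension functions and the `Φ`-dimensions of a measure -/

/-- A dimension function `Φ : (0,1) → [0,∞)`; only the values on `(0,1)` matter. -/
structure IsDimensionFunction (Φ : ℝ → ℝ) : Prop where
  nonneg : ∀ t ∈ Ioo (0 : ℝ) 1, 0 ≤ Φ t
  monotoneOn : MonotoneOn (fun t : ℝ => t ^ (1 + Φ t)) (Ioo 0 1)
  tendsto_zero : Tendsto (fun t : ℝ => t ^ (1 + Φ t)) (𝓝[>] 0) (𝓝 0)
  doubling : ∃ T C : ℝ, 0 < T ∧ T ≤ 1 / 2 ∧ 0 < C ∧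
    ∀ t : ℝ, 0 < t → t < T → (2 * t) ^ (1 + Φ (2 * t)) ≤ C * t ^ (1 + Φ t)

/-- `Φ` is large: `Φ(t) = H(t) log|log t| / |log t|` (for small `t`) with `H(t) → ∞` as `t → 0`. -/
def IsLarge (Φ : ℝ → ℝ) : Prop :=
  ∃ H : ℝ → ℝ, Tendsto H (𝓝[>] 0) atTop ∧
    ∀ᶠ t in 𝓝[>] (0 : ℝ), Φ t = H t * (Real.log |Real.log t| / |Real.log t|)

/-- The upper `Φ`-dimension of a probability measure, as an extended real. The radii `R` are kept
below `1`, where `Φ` is defined. -/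
def upperPhiDim {X : Type*} [PseudoMetricSpace X] [MeasurableSpace X]
    (Φ : ℝ → ℝ) (μ : Measure X) : EReal :=
  sInf {D : EReal | ∃ d : ℝ, D = (d : EReal) ∧ ∃ C₁ C₂ : ℝ, 0 < C₁ ∧ C₁ < 1 ∧ 0 < C₂ ∧
    ∀ r R : ℝ, 0 < r → r < R ^ (1 + Φ R) → R ^ (1 + Φ R) ≤ R → R ≤ C₁ → ∀ x ∈ μ.support,
      μ.real (Metric.ball x R) / μ.real (Metric.ball x r) ≤ C₂ * (R / r) ^ d}

/-- The lower `Φ`-dimension of a probability measure, as an extended real. -/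
def lowerPhiDim {X : Type*} [PseudoMetricSpace X] [MeasurableSpace X]
    (Φ : ℝ → ℝ) (μ : Measure X) : EReal :=
  sSup {D : EReal | ∃ d : ℝ, D = (d : EReal) ∧ ∃ C₁ C₂ : ℝ, 0 < C₁ ∧ C₁ < 1 ∧ 0 < C₂ ∧
    ∀ r R : ℝ, 0 < r → r < R ^ (1 + Φ R) → R ^ (1 + Φ R) ≤ R → R ≤ C₁ → ∀ x ∈ μ.support,
      C₂ * (R / r) ^ d ≤ μ.real (Metric.ball x R) / μ.real (Metric.ball x r)}

/-! ### Minimal extremal indices -/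

theorem argmaxSet_nonempty {K : ℕ} (hK : 2 ≤ K) (f : Fin K → ℝ) :
    (Finset.univ.filter (fun j : Fin K => ∀ k, f k ≤ f j)).Nonempty := by
  have : Nonempty (Fin K) := ⟨⟨0, by omega⟩⟩
  obtain ⟨j, hj⟩ := Finite.exists_max f
  exact ⟨j, by simpa using hj⟩

theorem argminSet_nonempty {K : ℕ} (hK : 2 ≤ K) (f : Fin K → ℝ) :
    (Finset.univ.filter (fun j : Fin K => ∀ k, f j ≤ f k)).Nonempty := by
  have : Nonempty (Fin K) := ⟨⟨0, by omega⟩⟩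
  obtain ⟨j, hj⟩ := Finite.exists_min f
  exact ⟨j, by simpa using hj⟩

/-- The least index at which `f` attains its maximum. -/
def firstArgmax {K : ℕ} (hK : 2 ≤ K) (f : Fin K → ℝ) : Fin K :=
  (Finset.univ.filter (fun j : Fin K => ∀ k, f k ≤ f j)).min' (argmaxSet_nonempty hK f)

/-- The least index at which `f` attains its minimum. -/
def firstArgmin {K : ℕ} (hK : 2 ≤ K) (f : Fin K → ℝ) : Fin K :=
  (Finset.univ.filter (fun j : Fin K => ∀ k, f j ≤ f k)).min' (argminSet_nonempty hK f)

/-! ### The random model -/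

/-- The deterministic data of the model: for every `u : 𝒜` an iterated function system of `K`
similarities of `[0,1]`, with scaling ratios bounded as stated and uniformly separated images, and
for every `v : 𝒲` a probability vector of length `K`. -/
structure Model (𝒜 𝒲 : Type*) [MeasurableSpace 𝒜] [MeasurableSpace 𝒲] where
  K : ℕ
  two_le_K : 2 ≤ K
  A : ℝ
  B : ℝ
  τ : ℝ
  A_pos : 0 < A
  τ_pos : 0 < τ
  K_mul_A_le : K * A ≤ B
  B_lt_one : B < 1
  τ_le : τ ≤ (1 - B) / K
  /-- the similarities -/
  S : Fin K → 𝒜 → unitInterval → unitInterval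
  /-- the scaling ratios -/
  a : Fin K → 𝒜 → ℝ
  dist_S : ∀ i u x y, dist (S i u x) (S i u y) = a i u * dist x y
  A_le_a : ∀ i u, A ≤ a i u
  sum_a_le : ∀ u, ∑ i, a i u ≤ B
  separated : ∀ u i j, i ≠ j → ∀ x y, τ ≤ dist (S i u x) (S j u y)
  measurable_a : ∀ i, Measurable (a i)
  /-- the probability weights -/
  p : Fin K → 𝒲 → ℝ
  p_nonneg : ∀ i v, 0 ≤ p i v
  sum_p : ∀ v, ∑ i, p i v = 1
  measurable_p : ∀ i, Measurable (p i)

namespace Model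

variable {𝒜 𝒲 : Type*} [MeasurableSpace 𝒜] [MeasurableSpace 𝒲] (M : Model 𝒜 𝒲)

/-- `S_{i₁}(ω₁) ∘ ⋯ ∘ S_{iₙ}(ωₙ)`, for a sequence `ω` of parameters and the first `n` letters of
the infinite word `i`. The sequences are indexed from `0`. -/
def comp (ω : ℕ → 𝒜 × 𝒲) (i : ℕ → Fin M.K) : ℕ → unitInterval → unitInterval
  | 0 => id
  | n + 1 => comp ω i n ∘ M.S (i n) (ω n).1

/-- The step `n` Moran interval `S_{i₁}(ω₁) ∘ ⋯ ∘ S_{iₙ}(ωₙ) [0,1]`. -/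
def moranInterval (ω : ℕ → 𝒜 × 𝒲) (i : ℕ → Fin M.K) (n : ℕ) : Set unitInterval :=
  range (M.comp ω i n)

/-- The point of the Moran set with address `i`: the limit of `S_{i₁}(ω₁) ∘ ⋯ ∘ S_{iₙ}(ωₙ) (0)`. -/
def coding (ω : ℕ → 𝒜 × 𝒲) (i : ℕ → Fin M.K) : unitInterval :=
  limUnder atTop (fun n => M.comp ω i n 0)

/-- The probability vector `p(·, v)` as a measure on the index set. -/
def weight (v : 𝒲) : Measure (Fin M.K) :=
  ∑ i, ENNReal.ofReal (M.p i v) • Measure.dirac i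

/-- The random measure `μ_ω`: the image under the coding map of the product of the weights
`p(·, ω₁), p(·, ω₂), …`. It is the probability measure with
`μ_ω(I_{i₁…iₙ}) = p(i₁, ω₁) ⋯ p(iₙ, ωₙ)`, see `moranMeasure_moranInterval` below. -/
def moranMeasure (ω : ℕ → 𝒜 × 𝒲) : Measure unitInterval :=
  (Measure.infinitePi (fun n => M.weight (ω n).2)).map (M.coding ω)

/-- `m(θ, l)`, the minimal index that maximizes `a(j, l)^θ / p(j, l)`. (The case of a vanishing
`p(j, l)` has probability zero in the model.) -/
def m (θ : ℝ) (l : 𝒜 × 𝒲) : Fin M.K :=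
  firstArgmax M.two_le_K (fun j => M.a j l.1 ^ θ / M.p j l.2)

/-- `m'(θ, l)`, the minimal index that minimizes `a(j, l)^θ / p(j, l)`. -/
def m' (θ : ℝ) (l : 𝒜 × 𝒲) : Fin M.K :=
  firstArgmin M.two_le_K (fun j => M.a j l.1 ^ θ / M.p j l.2)

/-- `G(θ) = 𝔼 log p(m(θ, l), l) / 𝔼 log a(m(θ, l), l)`. -/
def G (P : Measure (𝒜 × 𝒲)) (θ : ℝ) : ℝ :=
  (∫ l, Real.log (M.p (M.m θ l) l.2) ∂P) / (∫ l, Real.log (M.a (M.m θ l) l.1) ∂P)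

/-- `G'(θ) = 𝔼 log p(m'(θ, l), l) / 𝔼 log a(m'(θ, l), l)`. -/
def G' (P : Measure (𝒜 × 𝒲)) (θ : ℝ) : ℝ :=
  (∫ l, Real.log (M.p (M.m' θ l) l.2) ∂P) / (∫ l, Real.log (M.a (M.m' θ l) l.1) ∂P)

/-- The moment condition: for some `t > 0`, `𝔼 p(i, l)^{-t} < ∞` for every `i`. The power is taken
in `[0,∞]`, so that `0^{-t} = ∞`. -/
def MomentCondition (P : Measure (𝒜 × 𝒲)) : Prop :=
  ∃ t : ℝ, 0 < t ∧ ∀ i, ∫⁻ l, ENNReal.ofReal (M.p i l.2) ^ (-t) ∂P < ⊤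

/-! ### The coding map is well defined and `μ_ω` satisfies its defining rule -/

instance weight_isProbabilityMeasure (v : 𝒲) : IsProbabilityMeasure (M.weight v) := by
  constructor
  simp only [weight, Measure.coe_finsetSum, Finset.sum_apply, Measure.smul_apply, measure_univ,
    smul_eq_mul, mul_one]
  rw [← ENNReal.ofReal_sum_of_nonneg (fun i _ => M.p_nonneg i v), M.sum_p, ENNReal.ofReal_one]

theorem weight_singleton (v : 𝒲) (i : Fin M.K) :
    M.weight v {i} = ENNReal.ofReal (M.p i v) := by
  classical
  simp only [weight, Measure.coe_finsetSum, Finset.sum_apply, Measure.smul_apply,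
    Measure.dirac_apply, smul_eq_mul]
  rw [Finset.sum_eq_single i] <;> simp +contextual

theorem a_pos (i : Fin M.K) (u : 𝒜) : 0 < M.a i u := M.A_pos.trans_le (M.A_le_a i u)

theorem a_le_B (i : Fin M.K) (u : 𝒜) : M.a i u ≤ M.B :=
  (Finset.single_le_sum (fun j _ => (M.a_pos j u).le) (Finset.mem_univ i)).trans (M.sum_a_le u)

theorem B_pos : 0 < M.B := by
  have := M.two_le_K
  have hK : (0 : ℝ) < M.K := by exact_mod_cast (by omega : 0 < M.K)
  exact (mul_pos hK M.A_pos).trans_le M.K_mul_A_le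

theorem dist_comp (ω : ℕ → 𝒜 × 𝒲) (i : ℕ → Fin M.K) (n : ℕ) (x y : unitInterval) :
    dist (M.comp ω i n x) (M.comp ω i n y) =
      (∏ k ∈ Finset.range n, M.a (i k) (ω k).1) * dist x y := by
  induction n generalizing x y with
  | zero => simp [comp]
  | succ n ih => simp [comp, ih, M.dist_S, Finset.prod_range_succ, mul_assoc]

theorem dist_comp_le (ω : ℕ → 𝒜 × 𝒲) (i : ℕ → Fin M.K) (n : ℕ) (x y : unitInterval) :
    dist (M.comp ω i n x) (M.comp ω i n y) ≤ M.B ^ n := by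
  rw [dist_comp]
  have h1 : (∏ k ∈ Finset.range n, M.a (i k) (ω k).1) ≤ M.B ^ n := by
    calc _ ≤ ∏ k ∈ Finset.range n, M.B :=
          Finset.prod_le_prod (fun k _ => (M.a_pos _ _).le) (fun k _ => M.a_le_B _ _)
      _ = _ := by simp
  have h2 : dist x y ≤ 1 := by
    rw [Subtype.dist_eq, Real.dist_eq, abs_le]
    constructor <;> linarith [x.2.1, x.2.2, y.2.1, y.2.2]
  have h3 := pow_pos M.B_pos n
  nlinarith [dist_nonneg (x := x) (y := y)]

theorem moranInterval_antitone (ω : ℕ → 𝒜 × 𝒲) (i : ℕ → Fin M.K) :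
    Antitone (M.moranInterval ω i) := by
  refine antitone_nat_of_succ_le fun n => ?_
  rintro _ ⟨x, rfl⟩
  exact ⟨_, rfl⟩

theorem tendsto_coding (ω : ℕ → 𝒜 × 𝒲) (i : ℕ → Fin M.K) :
    Tendsto (fun n => M.comp ω i n 0) atTop (𝓝 (M.coding ω i)) := by
  have hc : CauchySeq (fun n => M.comp ω i n 0) := by
    refine cauchySeq_of_le_geometric M.B 1 M.B_lt_one fun n => ?_
    rw [one_mul]
    exact M.dist_comp_le ω i n 0 (M.S (i n) (ω n).1 0)
  exact tendsto_nhds_limUnder (cauchySeq_tendsto_of_complete hc)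

theorem continuous_comp (ω : ℕ → 𝒜 × 𝒲) (i : ℕ → Fin M.K) (n : ℕ) :
    Continuous (M.comp ω i n) := by
  refine LipschitzWith.continuous (K := Real.toNNReal
    (∏ k ∈ Finset.range n, M.a (i k) (ω k).1)) (LipschitzWith.of_dist_le_mul fun x y => ?_)
  rw [dist_comp, Real.coe_toNNReal _ (Finset.prod_nonneg fun k _ => (M.a_pos _ _).le)]

theorem coding_mem (ω : ℕ → 𝒜 × 𝒲) (i : ℕ → Fin M.K) (n : ℕ) :
    M.coding ω i ∈ M.moranInterval ω i n := by
  have hcl : IsClosed (M.moranInterval ω i n) :=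
    (isCompact_range (M.continuous_comp ω i n)).isClosed
  refine hcl.mem_of_tendsto (M.tendsto_coding ω i) ?_
  filter_upwards [eventually_ge_atTop n] with k hk
  exact M.moranInterval_antitone ω i hk ⟨0, rfl⟩

theorem comp_congr (ω : ℕ → 𝒜 × 𝒲) {i j : ℕ → Fin M.K} {n : ℕ} (h : ∀ k < n, i k = j k) :
    M.comp ω i n = M.comp ω j n := by
  induction n with
  | zero => rfl
  | succ n ih => rw [comp, comp, ih fun k hk => h k (by omega), h n (by omega)]

theorem eq_of_mem_moranInterval (ω : ℕ → 𝒜 × 𝒲) {i j : ℕ → Fin M.K} {n : ℕ} {x : unitInterval}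
    (hi : x ∈ M.moranInterval ω i n) (hj : x ∈ M.moranInterval ω j n) : ∀ k < n, i k = j k := by
  induction n with
  | zero => simp
  | succ n ih =>
    have h := ih (M.moranInterval_antitone ω i n.le_succ hi)
      (M.moranInterval_antitone ω j n.le_succ hj)
    intro k hk
    rcases Nat.lt_succ_iff_lt_or_eq.mp hk with hk | rfl
    · exact h k hk
    · by_contra hne
      obtain ⟨y, rfl⟩ := hi
      obtain ⟨z, hz⟩ := hj
      rw [comp, comp, ← M.comp_congr ω h] at hz
      have h0 := M.dist_comp ω i k (M.S (j k) (ω k).1 z) (M.S (i k) (ω k).1 y)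
      have hsep := M.separated (ω k).1 (j k) (i k) (Ne.symm hne) z y
      have hprod : 0 < ∏ l ∈ Finset.range k, M.a (i l) (ω l).1 :=
        Finset.prod_pos fun l _ => M.a_pos _ _
      simp only [Function.comp_apply] at hz
      rw [hz, dist_self] at h0
      have := mul_pos hprod (M.τ_pos.trans_le hsep)
      linarith

theorem coding_mem_iff (ω : ℕ → 𝒜 × 𝒲) (i j : ℕ → Fin M.K) (n : ℕ) :
    M.coding ω j ∈ M.moranInterval ω i n ↔ ∀ k < n, j k = i k := by
  constructor
  · exact fun h => M.eq_of_mem_moranInterval ω (M.coding_mem ω j n) h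
  · intro h
    have := M.coding_mem ω j n
    rwa [moranInterval, M.comp_congr ω h] at this

theorem continuous_coding (ω : ℕ → 𝒜 × 𝒲) : Continuous (M.coding ω) := by
  rw [Metric.continuous_iff']
  intro i ε hε
  obtain ⟨n, hn⟩ := exists_pow_lt_of_lt_one hε M.B_lt_one
  have hopen : ∀ᶠ j in 𝓝 i, ∀ k ∈ Finset.range n, j k = i k := by
    rw [Filter.eventually_all_finset]
    intro k _
    have h : ({i k} : Set (Fin M.K)) ∈ 𝓝 (i k) := by simp
    exact (continuous_apply k).continuousAt.eventually h
  filter_upwards [hopen] with j hj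
  obtain ⟨x, hx⟩ := (M.coding_mem_iff ω i j n).2 fun k hk => hj k (Finset.mem_range.2 hk)
  obtain ⟨y, hy⟩ := M.coding_mem ω i n
  rw [← hx, ← hy]
  exact (M.dist_comp_le ω i n x y).trans_lt hn

/-- The defining rule of `μ_ω`; for `n = 0` it says that `μ_ω([0,1]) = 1`. -/
theorem moranMeasure_moranInterval (ω : ℕ → 𝒜 × 𝒲) (i : ℕ → Fin M.K) (n : ℕ) :
    M.moranMeasure ω (M.moranInterval ω i n) =
      ∏ k ∈ Finset.range n, ENNReal.ofReal (M.p (i k) (ω k).2) := by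
  have hcl : IsClosed (M.moranInterval ω i n) :=
    (isCompact_range (M.continuous_comp ω i n)).isClosed
  have hpre : M.coding ω ⁻¹' (M.moranInterval ω i n) =
      Set.pi (Finset.range n : Finset ℕ) (fun k => {i k}) := by
    ext j
    simp [coding_mem_iff]
  rw [moranMeasure, Measure.map_apply (M.continuous_coding ω).measurable hcl.measurableSet, hpre,
    Measure.infinitePi_pi _ fun k _ => measurableSet_singleton _]
  exact Finset.prod_congr rfl fun k _ => M.weight_singleton _ _

end Model

end RandomMoran

end

/-!
The dimensions are read off the functions `gain d j l = log (a(j, l)^d / p(j, l))`: summed along a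
word over the steps `n, …, m - 1` they compare the ratio of the measures of the two Moran intervals
around a point with the `d`-th power of the ratio of their lengths (`Model.sum_Ico_gain`). Since
distinct pieces are uniformly separated, balls are comparable with Moran intervals
(`Model.mass_le_ball`, `Model.ball_le_mass`), and the restriction `r < R ^ (1 + Φ R)` for a large
`Φ` says that only windows of length at least `c log n` matter, with `c` as large as one likes
(`Model.exists_scale`).

At each step `gain d j l` is at most `gain d (m(d, l)) l` and at least `gain d (m'(d, l)) l`, and
the mean of `gain d (m(θ, l)) l` is positive, respectively negative, exactly when `d < G(θ)`,
respectively `d > G(θ)`; the same holds for `m'` and `G'`.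

* If `d > sup G`, then in particular `d > G(d)`, so `gain d (m(d, l)) l` has negative mean. It has
  exponential moments by the moment condition, and Chernoff's bound with the Borel–Cantelli lemma
  makes its sums nonpositive over all windows of logarithmic length that start late
  (`ae_window_sums_nonpos`). Uniformly in the word this bounds the growth of the measure, whence
  `d` bounds the upper dimension.
* If `d < G(θ)`, then by the law of large numbers the single point with address
  `m(θ, λ₁), m(θ, λ₂), …` violates the defining inequality of the upper dimension, already for a
  fixed `R` and `r → 0` (`Model.le_upperPhiDim_of_tendsto`).

The lower dimension is treated in the same way, with `m'` for `m` and all signs reversed.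
Nonpositive exponents are trivially admissible there, so only `d ≥ 0` needs the argument.
-/

/-! ### Sums of independent copies of a random variable -/

namespace RandomMoran

open ProbabilityTheory

theorem integrable_of_integrable_exp {Λ : Type*} [MeasurableSpace Λ] {P : Measure Λ} {X : Λ → ℝ}
    {t : ℝ} (ht : 0 < t)
    (h₁ : Integrable (fun l => Real.exp (t * X l)) P)
    (h₂ : Integrable (fun l => Real.exp (-t * X l)) P) : Integrable X P := by
  refine integrable_of_mem_interior_integrableExpSet (mem_interior_iff_mem_nhds.2
      (mem_of_superset (Icc_mem_nhds (a := -t) (b := t) (by linarith) ht) ?_))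
  rw [← segment_eq_Icc (by linarith)]
  exact convex_integrableExpSet.segment_subset h₂ h₁

section Prob

variable {Λ : Type*} [MeasurableSpace Λ] {P : Measure Λ} [IsProbabilityMeasure P] {X : Λ → ℝ}

/-- The moment generating function equals `1` at `0` and has negative derivative there. -/
theorem exists_mgf_lt_one {t : ℝ} (ht : 0 < t)
    (h₁ : Integrable (fun l => Real.exp (t * X l)) P)
    (h₂ : Integrable (fun l => Real.exp (-t * X l)) P) (hneg : ∫ l, X l ∂P < 0) :
    ∃ s : ℝ, 0 < s ∧ Integrable (fun l => Real.exp (s * X l)) P ∧ mgf X P s < 1 := by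
  have hsub : Icc (-t) t ⊆ integrableExpSet X P := by
    rw [← segment_eq_Icc (by linarith)]
    exact convex_integrableExpSet.segment_subset h₂ h₁
  have h0 : (0 : ℝ) ∈ interior (integrableExpSet X P) :=
    mem_interior_iff_mem_nhds.2
      (mem_of_superset (Icc_mem_nhds (by linarith) ht) hsub)
  have hd : HasDerivAt (mgf X P) (∫ l, X l ∂P) 0 := by
    simpa using hasDerivAt_mgf h0
  have hslope := (hasDerivAt_iff_tendsto_slope.1 hd).mono_left
    (nhdsWithin_mono (0 : ℝ) (s := Ioi 0) fun x hx => ne_of_gt hx)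
  have hev := hslope.eventually_lt_const hneg
  obtain ⟨s, hs, hs0⟩ := (hev.and (Ioo_mem_nhdsGT ht)).exists
  refine ⟨s, hs0.1, hsub ⟨by linarith [hs0.1], hs0.2.le⟩, ?_⟩
  rw [slope_def_field, mgf_zero, sub_zero, div_neg_iff] at hs
  rcases hs with hs | hs
  · linarith [hs0.1]
  · linarith

theorem integral_infinitePi_eval {g : Λ → ℝ} (hg : Measurable g) (k : ℕ) :
    ∫ ω, g (ω k) ∂(Measure.infinitePi (fun _ : ℕ => P)) = ∫ l, g l ∂P := by
  have h := integral_map (μ := Measure.infinitePi (fun _ : ℕ => P))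
    (measurable_pi_apply k).aemeasurable hg.aestronglyMeasurable
  rw [← h]
  exact congrArg (fun ν => ∫ l, g l ∂ν)
    (measurePreserving_eval_infinitePi (fun _ : ℕ => P) k).map_eq

/-- Chernoff's bound for one window of a sequence of independent copies of `X`. -/
theorem measureReal_window_sum_nonneg_le (hX : Measurable X) {s : ℝ} (hs : 0 < s)
    (hint : Integrable (fun l => Real.exp (s * X l)) P) (I : Finset ℕ) :
    (Measure.infinitePi (fun _ : ℕ => P)).real {ω | 0 ≤ ∑ k ∈ I, X (ω k)} ≤
      mgf X P s ^ I.card := by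
  have hmeas : ∀ k : ℕ, Measurable (fun ω : ℕ → Λ => X (ω k)) := fun k =>
    hX.comp (measurable_pi_apply k)
  have hind : iIndepFun (fun (k : ℕ) (ω : ℕ → Λ) => X (ω k))
      (Measure.infinitePi (fun _ : ℕ => P)) :=
    iIndepFun_infinitePi (X := fun _ => X) fun _ => hX
  have hmp := fun k : ℕ => measurePreserving_eval_infinitePi (fun _ : ℕ => P) k
  have hint' : ∀ k ∈ I, Integrable (fun ω : ℕ → Λ => Real.exp (s * X (ω k)))
      (Measure.infinitePi (fun _ : ℕ => P)) := fun k _ =>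
    (hmp k).integrable_comp_of_integrable (g := fun l => Real.exp (s * X l)) hint
  have hmgf : ∀ k : ℕ, mgf (fun ω : ℕ → Λ => X (ω k))
      (Measure.infinitePi (fun _ : ℕ => P)) s = mgf X P s := fun k =>
    integral_infinitePi_eval (g := fun l => Real.exp (s * X l)) (by fun_prop) k
  have h := measure_ge_le_exp_mul_mgf 0 hs.le (hind.integrable_exp_mul_sum hmeas hint')
  rw [hind.mgf_sum hmeas] at h
  simpa [hmgf, Finset.sum_apply] using h

/-- Along independent copies of a variable with negative mean and exponential moments, almost
surely no sum over a window `[n, m)` with `n` large and `m - n ≥ c log n` is positive. -/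
theorem ae_window_sums_nonpos (hX : Measurable X) {t : ℝ} (ht : 0 < t)
    (h₁ : Integrable (fun l => Real.exp (t * X l)) P)
    (h₂ : Integrable (fun l => Real.exp (-t * X l)) P) (hneg : ∫ l, X l ∂P < 0) :
    ∃ c : ℝ, 0 ≤ c ∧ ∀ᵐ ω ∂(Measure.infinitePi (fun _ : ℕ => P)), ∃ n₀ : ℕ, ∀ n m : ℕ,
      n₀ ≤ n → n ≤ m → c * Real.log n ≤ (m : ℝ) - n → ∑ k ∈ Finset.Ico n m, X (ω k) ≤ 0 := by
  obtain ⟨s, hs, hint, hlt⟩ := exists_mgf_lt_one ht h₁ h₂ hneg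
  have hpos : 0 < mgf X P s := mgf_pos hint
  -- Half of the decay `σ ^ (2 L)` makes the sum over `L` converge, the other half, by
  -- `L ≥ c log n`, the sum over `n`.
  set σ := √(mgf X P s) with hσ
  have hσ0 : 0 < σ := Real.sqrt_pos.2 hpos
  have hσ1 : σ < 1 := by rw [hσ, Real.sqrt_lt' one_pos]; simpa using hlt
  have hσ2 : mgf X P s = σ * σ := (Real.mul_self_sqrt hpos.le).symm
  have hlog : Real.log σ < 0 := Real.log_neg hσ0 hσ1
  refine ⟨2 / (-Real.log σ), by apply div_nonneg <;> linarith, ?_⟩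
  set c := 2 / (-Real.log σ) with hc
  have hclog : c * -Real.log σ = 2 := div_mul_cancel₀ _ (by linarith)
  let bad : ℕ × ℕ → Set (ℕ → Λ) := fun q =>
    {ω | 1 ≤ q.1 ∧ c * Real.log q.1 ≤ q.2 ∧ 0 < ∑ k ∈ Finset.Ico q.1 (q.1 + q.2), X (ω k)}
  have hbound : ∀ q, (Measure.infinitePi (fun _ : ℕ => P)) (bad q) ≤
      ENNReal.ofReal ((1 / (q.1 : ℝ) ^ 2) * σ ^ q.2) := by
    rintro ⟨n, L⟩
    by_cases hq : 1 ≤ n ∧ c * Real.log n ≤ L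
    swap
    · have : bad (n, L) = ∅ := by
        ext ω
        simp only [bad, mem_ofPred_eq, mem_empty_iff_false, iff_false]
        tauto
      simp [this]
    rw [← ofReal_measureReal]
    refine ENNReal.ofReal_le_ofReal ?_
    have hn : (0 : ℝ) < n := by exact_mod_cast hq.1
    calc _ ≤ (Measure.infinitePi (fun _ : ℕ => P)).real
            {ω | 0 ≤ ∑ k ∈ Finset.Ico n (n + L), X (ω k)} :=
          measureReal_mono fun ω hω => hω.2.2.le
      _ ≤ mgf X P s ^ L := by
          simpa using measureReal_window_sum_nonneg_le hX hs hint (Finset.Ico n (n + L))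
      _ = σ ^ L * σ ^ L := by rw [hσ2, mul_pow]
      _ ≤ _ := by
          refine mul_le_mul_of_nonneg_right ?_ (pow_nonneg hσ0.le _)
          rw [← Real.log_le_log_iff (pow_pos hσ0 _) (by positivity), Real.log_pow, one_div,
            Real.log_inv, Real.log_pow]
          have := mul_le_mul_of_nonneg_right hq.2 (neg_nonneg.2 hlog.le)
          have h2 : c * Real.log n * -Real.log σ = 2 * Real.log n := by
            rw [mul_right_comm, hclog]
          push_cast
          linarith
  have hsum : Summable fun q : ℕ × ℕ => (1 / (q.1 : ℝ) ^ 2) * σ ^ q.2 :=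
    (Real.summable_one_div_nat_pow.2 one_lt_two).mul_of_nonneg
      (summable_geometric_of_lt_one hσ0.le hσ1) (fun n => by positivity)
      (fun n => pow_nonneg hσ0.le _)
  have hfin : ∑' q, (Measure.infinitePi (fun _ : ℕ => P)) (bad q) ≠ ⊤ := by
    refine ne_top_of_le_ne_top ?_ (ENNReal.tsum_le_tsum hbound)
    exact hsum.tsum_ofReal_ne_top
  filter_upwards [ae_finite_setOfPred_mem hfin] with ω hω
  obtain ⟨N, hN⟩ := (hω.image Prod.fst).bddAbove
  refine ⟨N + 1, fun n m hn hnm hL => ?_⟩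
  by_contra! hlt
  have hmem : ω ∈ bad (n, m - n) := by
    refine ⟨by omega, ?_, ?_⟩
    · rw [Nat.cast_sub hnm]; exact hL
    · simpa [Nat.add_sub_cancel' hnm] using hlt
  have := hN (mem_image_of_mem Prod.fst hmem)
  simp only at this
  omega

/-- Along independent copies of a variable with positive mean, the sums tend to infinity. -/
theorem ae_tendsto_sum_atTop (hX : Measurable X) (hint : Integrable X P) (hpos : 0 < ∫ l, X l ∂P) :
    ∀ᵐ ω ∂(Measure.infinitePi (fun _ : ℕ => P)),
      Tendsto (fun n => ∑ k ∈ Finset.range n, X (ω k)) atTop atTop := by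
  have hmp := fun k : ℕ => measurePreserving_eval_infinitePi (fun _ : ℕ => P) k
  have hind : iIndepFun (fun (k : ℕ) (ω : ℕ → Λ) => X (ω k))
      (Measure.infinitePi (fun _ : ℕ => P)) :=
    iIndepFun_infinitePi (X := fun _ => X) fun _ => hX
  have hmap : ∀ k : ℕ, (Measure.infinitePi (fun _ : ℕ => P)).map (fun ω : ℕ → Λ => X (ω k)) =
      P.map X := fun k =>
    (Measure.map_map hX (measurable_pi_apply k)).symm.trans
      (congrArg (Measure.map X) (hmp k).map_eq)
  have hslln := strong_law_ae_real (μ := Measure.infinitePi (fun _ : ℕ => P))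
    (fun (k : ℕ) (ω : ℕ → Λ) => X (ω k))
    ((hmp 0).integrable_comp_of_integrable (g := X) hint)
    (fun i j hij => hind.indepFun hij)
    (fun k => ⟨(hX.comp (measurable_pi_apply k)).aemeasurable,
      (hX.comp (measurable_pi_apply 0)).aemeasurable, by rw [hmap, hmap]⟩)
  filter_upwards [hslln] with ω hω
  rw [integral_infinitePi_eval hX] at hω
  refine (hω.pos_mul_atTop hpos tendsto_natCast_atTop_atTop).congr' ?_
  filter_upwards [eventually_gt_atTop 0] with n hn
  have : (n : ℝ) ≠ 0 := by exact_mod_cast hn.ne'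
  field_simp

end Prob

end RandomMoran

/-! ### Extremal selectors -/

namespace RandomMoran

theorem le_firstArgmax {K : ℕ} (hK : 2 ≤ K) (f : Fin K → ℝ) (k : Fin K) :
    f k ≤ f (firstArgmax hK f) := by
  have h := Finset.min'_mem _ (argmaxSet_nonempty hK f)
  exact (Finset.mem_filter.1 h).2 k

theorem firstArgmin_eq {K : ℕ} (hK : 2 ≤ K) (f : Fin K → ℝ) :
    firstArgmin hK f = firstArgmax hK (fun j => -f j) := by
  simp [firstArgmin, firstArgmax]

theorem firstArgmin_le {K : ℕ} (hK : 2 ≤ K) (f : Fin K → ℝ) (k : Fin K) :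
    f (firstArgmin hK f) ≤ f k := by
  rw [firstArgmin_eq]
  exact neg_le_neg_iff.1 (le_firstArgmax hK (fun j => -f j) k)

theorem firstArgmax_eq_iff {K : ℕ} (hK : 2 ≤ K) (f : Fin K → ℝ) (j : Fin K) :
    firstArgmax hK f = j ↔ (∀ k, f k ≤ f j) ∧ ∀ i < j, ¬ ∀ k, f k ≤ f i := by
  constructor
  · rintro rfl
    refine ⟨le_firstArgmax hK f, fun i hi h => ?_⟩
    exact absurd (Finset.min'_le _ i (by simpa using h)) (not_le.2 hi)
  · rintro ⟨h₁, h₂⟩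
    refine le_antisymm (Finset.min'_le _ j (by simpa using h₁)) ?_
    by_contra! hlt
    exact h₂ _ hlt (le_firstArgmax hK f)

theorem measurable_firstArgmax {Λ : Type*} [MeasurableSpace Λ] {K : ℕ} (hK : 2 ≤ K)
    {f : Fin K → Λ → ℝ} (hf : ∀ j, Measurable (f j)) :
    Measurable (fun l => firstArgmax hK (fun j => f j l)) := by
  refine measurable_to_countable' fun j => ?_
  have : (fun l => firstArgmax hK (fun j => f j l)) ⁻¹' {j} =
      {l | (∀ k, f k l ≤ f j l) ∧ ∀ i < j, ¬ ∀ k, f k l ≤ f i l} := by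
    ext l
    exact firstArgmax_eq_iff hK _ j
  rw [this]
  measurability

namespace Model

variable {𝒜 𝒲 : Type*} [MeasurableSpace 𝒜] [MeasurableSpace 𝒲] (M : Model 𝒜 𝒲)

theorem measurable_rpow_a_div_p (θ : ℝ) (j : Fin M.K) :
    Measurable fun l : 𝒜 × 𝒲 => M.a j l.1 ^ θ / M.p j l.2 := by
  have h₁ : Measurable fun l : 𝒜 × 𝒲 => M.a j l.1 := (M.measurable_a j).comp measurable_fst
  have h₂ : Measurable fun l : 𝒜 × 𝒲 => M.p j l.2 := (M.measurable_p j).comp measurable_snd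
  exact (h₁.pow_const θ).div h₂

theorem measurable_m (θ : ℝ) : Measurable (M.m θ) :=
  measurable_firstArgmax M.two_le_K (M.measurable_rpow_a_div_p θ)

theorem measurable_m' (θ : ℝ) : Measurable (M.m' θ) := by
  have h : M.m' θ = fun l => firstArgmax M.two_le_K
      (fun j => -(M.a j l.1 ^ θ / M.p j l.2)) := funext fun l => firstArgmin_eq _ _
  rw [h]
  exact measurable_firstArgmax M.two_le_K fun j => (M.measurable_rpow_a_div_p θ j).neg

/-- `log (a(j, l)^d / p(j, l))`, see `exp_gain`. Its sums along a word compare the measure of a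
Moran interval with the `d`-th power of its length. -/
noncomputable def gain (d : ℝ) (j : Fin M.K) (l : 𝒜 × 𝒲) : ℝ :=
  d * Real.log (M.a j l.1) - Real.log (M.p j l.2)

theorem exp_gain {d : ℝ} {j : Fin M.K} {l : 𝒜 × 𝒲} (hp : 0 < M.p j l.2) :
    Real.exp (M.gain d j l) = M.a j l.1 ^ d / M.p j l.2 := by
  rw [gain, Real.exp_sub, Real.exp_log hp, Real.rpow_def_of_pos (M.a_pos _ _), mul_comm]

theorem gain_le_gain_m {d : ℝ} {l : 𝒜 × 𝒲} (hp : ∀ j, 0 < M.p j l.2) (j : Fin M.K) :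
    M.gain d j l ≤ M.gain d (M.m d l) l := by
  rw [← Real.exp_le_exp, M.exp_gain (hp _), M.exp_gain (hp _)]
  exact le_firstArgmax M.two_le_K (fun j => M.a j l.1 ^ d / M.p j l.2) j

theorem gain_m'_le_gain {d : ℝ} {l : 𝒜 × 𝒲} (hp : ∀ j, 0 < M.p j l.2) (j : Fin M.K) :
    M.gain d (M.m' d l) l ≤ M.gain d j l := by
  rw [← Real.exp_le_exp, M.exp_gain (hp _), M.exp_gain (hp _)]
  exact firstArgmin_le M.two_le_K (fun j => M.a j l.1 ^ d / M.p j l.2) j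

theorem p_le_one (j : Fin M.K) (v : 𝒲) : M.p j v ≤ 1 := by
  rw [← M.sum_p v]
  exact Finset.single_le_sum (fun j _ => M.p_nonneg j v) (Finset.mem_univ j)

theorem A_le_B : M.A ≤ M.B := by
  have h : (1 : ℝ) ≤ M.K := by exact_mod_cast one_le_two.trans M.two_le_K
  nlinarith [M.A_pos, M.K_mul_A_le]

theorem A_lt_one : M.A < 1 := M.A_le_B.trans_lt M.B_lt_one

theorem τ_lt_one : M.τ < 1 := by
  have h : (2 : ℝ) ≤ M.K := by exact_mod_cast M.two_le_K
  have := M.τ_le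
  rw [le_div_iff₀ (by linarith)] at this
  nlinarith [M.τ_pos, M.B_pos]

theorem abs_log_a_le (j : Fin M.K) (u : 𝒜) : |Real.log (M.a j u)| ≤ -Real.log M.A := by
  rw [abs_of_nonpos (Real.log_nonpos (M.a_pos j u).le ((M.a_le_B j u).trans M.B_lt_one.le))]
  exact neg_le_neg (Real.log_le_log M.A_pos (M.A_le_a j u))

section Moments

variable {P : Measure (𝒜 × 𝒲)}

/-- In the moment condition `0 ^ (-t) = ∞`, so the weights are almost surely positive. -/
theorem ae_p_pos (hP : M.MomentCondition P) : ∀ᵐ l ∂P, ∀ j, 0 < M.p j l.2 := by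
  obtain ⟨t, ht, h⟩ := hP
  rw [ae_all_iff]
  intro j
  have hmeas : Measurable fun l : 𝒜 × 𝒲 => ENNReal.ofReal (M.p j l.2) ^ (-t) :=
    (((M.measurable_p j).comp measurable_snd).ennreal_ofReal).pow_const _
  filter_upwards [ae_lt_top hmeas (h j).ne] with l hl
  by_contra! hle
  rw [ENNReal.ofReal_of_nonpos hle, ENNReal.zero_rpow_of_neg (neg_lt_zero.2 ht)] at hl
  exact lt_irrefl _ hl

theorem ae_forall_p_pos [IsProbabilityMeasure P] (hP : M.MomentCondition P) :
    ∀ᵐ ω ∂(Measure.infinitePi (fun _ : ℕ => P)), ∀ k j, 0 < M.p j (ω k).2 := by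
  rw [ae_all_iff]
  intro k
  exact (measurePreserving_eval_infinitePi (fun _ : ℕ => P) k).quasiMeasurePreserving.ae
    (M.ae_p_pos hP)

variable {s : 𝒜 × 𝒲 → Fin M.K}

theorem measurable_select {f : Fin M.K → 𝒜 × 𝒲 → ℝ} (hf : ∀ j, Measurable (f j))
    (hs : Measurable s) : Measurable fun l => f (s l) l := by
  have h : Measurable fun q : (𝒜 × 𝒲) × Fin M.K => f q.2 q.1 :=
    measurable_from_prod_countable_left hf
  exact h.comp (measurable_id.prodMk hs)

theorem measurable_gain (d : ℝ) (hs : Measurable s) : Measurable fun l => M.gain d (s l) l :=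
  M.measurable_select (f := M.gain d) (fun j =>
    (((M.measurable_a j).comp measurable_fst).log.const_mul d).sub
      ((M.measurable_p j).comp measurable_snd).log) hs

/-- The moment condition gives exponential moments of both signs for every selector. -/
theorem integrable_exp_gain [IsProbabilityMeasure P] (hP : M.MomentCondition P) (d : ℝ)
    (hs : Measurable s) : ∃ t : ℝ, 0 < t ∧
      Integrable (fun l => Real.exp (t * M.gain d (s l) l)) P ∧
      Integrable (fun l => Real.exp (-t * M.gain d (s l) l)) P := by
  have hpos := M.ae_p_pos hP
  obtain ⟨t, ht, h⟩ := hP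
  have hint : ∀ j, Integrable (fun l : 𝒜 × 𝒲 => M.p j l.2 ^ (-t)) P := fun j => by
    have hmeas : Measurable fun l : 𝒜 × 𝒲 => ENNReal.ofReal (M.p j l.2) ^ (-t) :=
      (((M.measurable_p j).comp measurable_snd).ennreal_ofReal).pow_const _
    refine (integrable_toReal_of_lintegral_ne_top hmeas.aemeasurable (h j).ne).congr ?_
    filter_upwards [hpos] with l hl
    rw [ENNReal.ofReal_rpow_of_pos (hl j),
      ENNReal.toReal_ofReal (Real.rpow_nonneg (hl j).le _)]
  set c := t * (|d| * -Real.log M.A) with hc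
  have hdom : Integrable (fun l : 𝒜 × 𝒲 => Real.exp c * ∑ j, M.p j l.2 ^ (-t)) P :=
    (integrable_finsetSum _ fun j _ => hint j).const_mul _
  have hle : ∀ᵐ l ∂P, ∀ e : ℝ, e ≤ t * |M.gain d (s l) l| →
      ‖Real.exp e‖ ≤ Real.exp c * ∑ j, M.p j l.2 ^ (-t) := by
    filter_upwards [hpos] with l hl e he
    have h1 : |M.gain d (s l) l| ≤ |d| * -Real.log M.A + -Real.log (M.p (s l) l.2) := by
      refine (abs_sub _ _).trans (add_le_add ?_ ?_)
      · rw [abs_mul]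
        exact mul_le_mul_of_nonneg_left (M.abs_log_a_le _ _) (abs_nonneg d)
      · rw [abs_of_nonpos (Real.log_nonpos (hl _).le (M.p_le_one _ _))]
    rw [Real.norm_eq_abs, Real.abs_exp]
    calc Real.exp e ≤ Real.exp (c + Real.log (M.p (s l) l.2) * (-t)) := by
          refine Real.exp_le_exp.2 (he.trans ?_)
          have := mul_le_mul_of_nonneg_left h1 ht.le
          rw [hc]; linarith
      _ = Real.exp c * M.p (s l) l.2 ^ (-t) := by
          rw [Real.exp_add, Real.rpow_def_of_pos (hl _)]
      _ ≤ _ := mul_le_mul_of_nonneg_left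
          (Finset.single_le_sum (f := fun j => M.p j l.2 ^ (-t))
            (fun j _ => Real.rpow_nonneg (hl j).le _) (Finset.mem_univ (s l)))
          (Real.exp_pos _).le
  have hmeas := M.measurable_gain d hs
  refine ⟨t, ht, hdom.mono' ?_ ?_, hdom.mono' ?_ ?_⟩
  · exact (hmeas.const_mul t).exp.aestronglyMeasurable
  · filter_upwards [hle] with l hl
    exact hl _ (mul_le_mul_of_nonneg_left (le_abs_self _) ht.le)
  · exact (hmeas.const_mul (-t)).exp.aestronglyMeasurable
  · filter_upwards [hle] with l hl
    refine hl _ ?_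
    rw [neg_mul_comm]
    exact mul_le_mul_of_nonneg_left (neg_le_abs _) ht.le

theorem integrable_gain [IsProbabilityMeasure P] (hP : M.MomentCondition P) (d : ℝ)
    (hs : Measurable s) : Integrable (fun l => M.gain d (s l) l) P := by
  obtain ⟨t, ht, h₁, h₂⟩ := M.integrable_exp_gain hP d hs
  exact integrable_of_integrable_exp ht h₁ h₂

theorem integrable_log_a [IsProbabilityMeasure P] (hs : Measurable s) :
    Integrable (fun l => Real.log (M.a (s l) l.1)) P :=
  Integrable.of_bound (M.measurable_select (f := fun j l => Real.log (M.a j l.1))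
    (fun j => ((M.measurable_a j).comp measurable_fst).log) hs).aestronglyMeasurable
    (-Real.log M.A) (ae_of_all _ fun _ => M.abs_log_a_le _ _)

theorem integral_log_a_neg [IsProbabilityMeasure P] (hs : Measurable s) :
    ∫ l, Real.log (M.a (s l) l.1) ∂P < 0 := by
  have h : ∫ l, Real.log (M.a (s l) l.1) ∂P ≤ ∫ _, Real.log M.B ∂P :=
    integral_mono (M.integrable_log_a hs) (integrable_const _) fun _ =>
      Real.log_le_log (M.a_pos _ _) (M.a_le_B _ _)
  rw [integral_const, probReal_univ, one_smul] at h
  exact h.trans_lt (Real.log_neg M.B_pos M.B_lt_one)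

theorem integral_gain [IsProbabilityMeasure P] (hP : M.MomentCondition P) (d : ℝ)
    (hs : Measurable s) : ∫ l, M.gain d (s l) l ∂P =
      d * ∫ l, Real.log (M.a (s l) l.1) ∂P - ∫ l, Real.log (M.p (s l) l.2) ∂P := by
  have hp : Integrable (fun l => Real.log (M.p (s l) l.2)) P := by
    simpa [gain] using (M.integrable_gain hP 0 hs).neg
  simp only [gain]
  rw [integral_sub ((M.integrable_log_a hs).const_mul d) hp, integral_const_mul]

/-- The division by a negative mean of `log a` reverses the inequality: a small exponent `d` makes
the mean gain positive. -/
theorem integral_gain_pos [IsProbabilityMeasure P] (hP : M.MomentCondition P) {d : ℝ}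
    (hs : Measurable s)
    (h : d < (∫ l, Real.log (M.p (s l) l.2) ∂P) / ∫ l, Real.log (M.a (s l) l.1) ∂P) :
    0 < ∫ l, M.gain d (s l) l ∂P := by
  rw [lt_div_iff_of_neg (M.integral_log_a_neg hs)] at h
  rw [M.integral_gain hP d hs]
  linarith

theorem integral_gain_neg [IsProbabilityMeasure P] (hP : M.MomentCondition P) {d : ℝ}
    (hs : Measurable s)
    (h : (∫ l, Real.log (M.p (s l) l.2) ∂P) / ∫ l, Real.log (M.a (s l) l.1) ∂P < d) :
    ∫ l, M.gain d (s l) l ∂P < 0 := by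
  rw [div_lt_iff_of_neg (M.integral_log_a_neg hs)] at h
  rw [M.integral_gain hP d hs]
  linarith

theorem G_nonneg (P : Measure (𝒜 × 𝒲)) (θ : ℝ) : 0 ≤ M.G P θ :=
  div_nonneg_of_nonpos
    (integral_nonpos fun _ => Real.log_nonpos (M.p_nonneg _ _) (M.p_le_one _ _))
    (integral_nonpos fun _ =>
      Real.log_nonpos (M.a_pos _ _).le ((M.a_le_B _ _).trans M.B_lt_one.le))

end Moments

end Model

end RandomMoran

/-! ### Moran intervals and balls -/

namespace RandomMoran

namespace Model

variable {𝒜 𝒲 : Type*} [MeasurableSpace 𝒜] [MeasurableSpace 𝒲] (M : Model 𝒜 𝒲)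

/-- The length of the step `n` Moran interval with address `i`. -/
def len (ω : ℕ → 𝒜 × 𝒲) (i : ℕ → Fin M.K) (n : ℕ) : ℝ :=
  ∏ k ∈ Finset.range n, M.a (i k) (ω k).1

/-- The measure of the step `n` Moran interval with address `i`. -/
def mass (ω : ℕ → 𝒜 × 𝒲) (i : ℕ → Fin M.K) (n : ℕ) : ℝ :=
  ∏ k ∈ Finset.range n, M.p (i k) (ω k).2

variable {M} {ω : ℕ → 𝒜 × 𝒲} {i : ℕ → Fin M.K}

theorem len_pos (n : ℕ) : 0 < M.len ω i n := Finset.prod_pos fun _ _ => M.a_pos _ _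

theorem len_succ (n : ℕ) : M.len ω i (n + 1) = M.len ω i n * M.a (i n) (ω n).1 :=
  Finset.prod_range_succ _ _

theorem len_antitone : Antitone (M.len ω i) := by
  refine antitone_nat_of_succ_le fun n => ?_
  rw [len_succ]
  exact mul_le_of_le_one_right (len_pos n).le ((M.a_le_B _ _).trans M.B_lt_one.le)

theorem A_mul_len_le (n : ℕ) : M.A * M.len ω i n ≤ M.len ω i (n + 1) := by
  rw [len_succ, mul_comm]
  exact mul_le_mul_of_nonneg_left (M.A_le_a _ _) (len_pos n).le

theorem A_pow_mul_len_le {n m : ℕ} (h : n ≤ m) :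
    M.A ^ (m - n) * M.len ω i n ≤ M.len ω i m := by
  induction m, h using Nat.le_induction with
  | base => simp
  | succ m h ih =>
    rw [Nat.succ_sub h, pow_succ, mul_right_comm, mul_comm]
    exact (mul_le_mul_of_nonneg_left ih M.A_pos.le).trans (A_mul_len_le m)

theorem A_pow_le_len (n : ℕ) : M.A ^ n ≤ M.len ω i n := by
  simpa [len] using A_pow_mul_len_le (M := M) (ω := ω) (i := i) (Nat.zero_le n)

theorem len_le_B_pow (n : ℕ) : M.len ω i n ≤ M.B ^ n :=
  (Finset.prod_le_prod (fun k _ => (M.a_pos _ _).le) (fun k _ => M.a_le_B _ _)).trans (by simp)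

theorem tendsto_len : Tendsto (M.len ω i) atTop (𝓝 0) :=
  squeeze_zero (fun n => (len_pos n).le) len_le_B_pow
    (tendsto_pow_atTop_nhds_zero_of_lt_one M.B_pos.le M.B_lt_one)

/-- The lengths of the Moran intervals around a point pass through every scale. -/
theorem exists_len (ω : ℕ → 𝒜 × 𝒲) (i : ℕ → Fin M.K) {ρ : ℝ} (h₀ : 0 < ρ) (h₁ : ρ ≤ 1) :
    ∃ n, ρ ≤ M.len ω i n ∧ M.len ω i (n + 1) < ρ := by
  classical
  have hex : ∃ n, M.len ω i n < ρ := (tendsto_len.eventually_lt_const h₀).exists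
  have hne : Nat.find hex ≠ 0 := fun h => by
    have := Nat.find_spec hex
    rw [h] at this
    simp [len] at this
    linarith
  obtain ⟨n, hn⟩ := Nat.exists_eq_succ_of_ne_zero hne
  refine ⟨n, not_lt.1 (Nat.find_min hex (by omega)), ?_⟩
  have := Nat.find_spec hex
  rwa [hn] at this

theorem mass_pos (hp : ∀ k j, 0 < M.p j (ω k).2) (n : ℕ) : 0 < M.mass ω i n :=
  Finset.prod_pos fun _ _ => hp _ _

instance moranMeasure_isProbabilityMeasure : IsProbabilityMeasure (M.moranMeasure ω) :=
  Measure.isProbabilityMeasure_map (M.continuous_coding ω).measurable.aemeasurable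

theorem moranMeasure_real_moranInterval (n : ℕ) :
    (M.moranMeasure ω).real (M.moranInterval ω i n) = M.mass ω i n := by
  rw [measureReal_def, moranMeasure_moranInterval, ENNReal.toReal_prod, mass]
  exact Finset.prod_congr rfl fun k _ => ENNReal.toReal_ofReal (M.p_nonneg _ _)

theorem mass_le_ball {n : ℕ} {r : ℝ} (h : M.len ω i n < r) :
    M.mass ω i n ≤ (M.moranMeasure ω).real (Metric.ball (M.coding ω i) r) := by
  rw [← moranMeasure_real_moranInterval]
  refine measureReal_mono ?_
  rintro _ ⟨x, rfl⟩
  obtain ⟨y, hy⟩ := M.coding_mem ω i n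
  rw [Metric.mem_ball, ← hy, dist_comp]
  refine lt_of_le_of_lt (mul_le_of_le_one_right (len_pos n).le ?_) h
  rw [Subtype.dist_eq, Real.dist_eq, abs_le]
  constructor <;> linarith [x.2.1, x.2.2, y.2.1, y.2.2]

/-- Points of the Moran set with addresses that part at step `k` are separated on the scale of
the common Moran interval of step `k`. -/
theorem τ_mul_len_le_dist {j : ℕ → Fin M.K} {k : ℕ} (h : ∀ l < k, j l = i l) (hk : j k ≠ i k) :
    M.τ * M.len ω i k ≤ dist (M.coding ω j) (M.coding ω i) := by
  obtain ⟨y, hy⟩ := M.coding_mem ω i (k + 1)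
  obtain ⟨z, hz⟩ := M.coding_mem ω j (k + 1)
  rw [← hy, ← hz, comp, comp, M.comp_congr ω h, Function.comp_apply, Function.comp_apply,
    dist_comp, mul_comm]
  exact mul_le_mul_of_nonneg_left (M.separated _ _ _ hk _ _) (len_pos k).le

/-- On the scale of the step `n` interval, a ball around a point of the Moran set meets no other
interval of that step. -/
theorem ball_le_mass {n : ℕ} {r : ℝ} (h : r ≤ M.τ * M.len ω i n) :
    (M.moranMeasure ω).real (Metric.ball (M.coding ω i) r) ≤ M.mass ω i n := by
  classical
  rw [← moranMeasure_real_moranInterval]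
  have hcl : IsClosed (M.moranInterval ω i n) :=
    (isCompact_range (M.continuous_comp ω i n)).isClosed
  have hmeas := (M.continuous_coding ω).measurable
  rw [moranMeasure, map_measureReal_apply hmeas Metric.isOpen_ball.measurableSet,
    map_measureReal_apply hmeas hcl.measurableSet]
  refine measureReal_mono fun j hj => (M.coding_mem_iff ω i j n).2 ?_
  by_contra! hne
  have hspec := Nat.find_spec hne
  have hd := τ_mul_len_le_dist (ω := ω)
    (fun l hl => not_not.1 fun h' => Nat.find_min hne hl ⟨hl.trans hspec.1, h'⟩) hspec.2
  have h2 := mul_le_mul_of_nonneg_left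
    (len_antitone (M := M) (ω := ω) (i := i) hspec.1.le) M.τ_pos.le
  have h3 : dist (M.coding ω j) (M.coding ω i) < r := hj
  linarith

theorem support_subset_range_coding : (M.moranMeasure ω).support ⊆ range (M.coding ω) := by
  have hcl : IsClosed (range (M.coding ω)) :=
    (isCompact_range (M.continuous_coding ω)).isClosed
  refine Measure.support_subset_of_isClosed hcl ?_
  exact (ae_map_iff (M.continuous_coding ω).measurable.aemeasurable hcl.measurableSet).2
    (ae_of_all _ fun j => mem_range_self j)

theorem ball_real_pos (hp : ∀ k j, 0 < M.p j (ω k).2) {r : ℝ} (hr : 0 < r) :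
    0 < (M.moranMeasure ω).real (Metric.ball (M.coding ω i) r) := by
  obtain ⟨n, hn⟩ := (tendsto_len (M := M) (ω := ω) (i := i)).eventually_lt_const hr |>.exists
  exact (mass_pos hp n).trans_le (mass_le_ball hn)

theorem coding_mem_support (hp : ∀ k j, 0 < M.p j (ω k).2) :
    M.coding ω i ∈ (M.moranMeasure ω).support := by
  rw [Metric.nhds_basis_ball.mem_measureSupport]
  intro r hr
  have := ball_real_pos (i := i) hp hr
  exact pos_iff_ne_zero.2 fun h0 => by simp [measureReal_def, h0] at this

theorem sum_gain (hp : ∀ k j, 0 < M.p j (ω k).2) (d : ℝ) (n : ℕ) :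
    ∑ k ∈ Finset.range n, M.gain d (i k) (ω k) =
      d * Real.log (M.len ω i n) - Real.log (M.mass ω i n) := by
  simp only [gain]
  rw [Finset.sum_sub_distrib, ← Finset.mul_sum, len, mass,
    Real.log_prod fun k _ => (M.a_pos _ _).ne', Real.log_prod fun k _ => (hp _ _).ne']

theorem sum_Ico_gain (hp : ∀ k j, 0 < M.p j (ω k).2) (d : ℝ) {n m : ℕ} (h : n ≤ m) :
    ∑ k ∈ Finset.Ico n m, M.gain d (i k) (ω k) =
      Real.log (M.mass ω i n / M.mass ω i m) -
        Real.log ((M.len ω i n / M.len ω i m) ^ d) := by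
  rw [Finset.sum_Ico_eq_sub _ h, sum_gain hp, sum_gain hp,
    Real.log_rpow (div_pos (len_pos n) (len_pos m)),
    Real.log_div (len_pos n).ne' (len_pos m).ne',
    Real.log_div (mass_pos hp n).ne' (mass_pos hp m).ne']
  ring

/-- For a large dimension function, the restriction `r < R ^ (1 + Φ R)` forces Moran intervals of
lengths comparable to `R` and `r` to be at least `c log n` steps apart. -/
theorem exists_scale {Φ : ℝ → ℝ} (hΦ : IsLarge Φ) {c κ : ℝ} (hc : 0 ≤ c) (hκ : 0 < κ)
    (hκ₁ : κ < 1) (n₀ : ℕ) (ω : ℕ → 𝒜 × 𝒲) :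
    ∃ C₁ : ℝ, 0 < C₁ ∧ C₁ < κ ∧ ∀ r R : ℝ, 0 < r → r < R ^ (1 + Φ R) → 0 < R → R ≤ C₁ →
      ∀ (i : ℕ → Fin M.K) (n m : ℕ), κ * R ≤ M.len ω i n → M.len ω i n ≤ R / κ →
        M.len ω i m ≤ r / κ → n₀ ≤ n ∧ n ≤ m ∧ c * Real.log n ≤ (m : ℝ) - n := by
  obtain ⟨H, hH, hΦH⟩ := hΦ
  have hy : Tendsto (fun R => |Real.log R|) (𝓝[>] 0) atTop :=
    tendsto_abs_atBot_atTop.comp Real.tendsto_log_nhdsGT_zero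
  have hu : Tendsto (fun R => Real.log |Real.log R|) (𝓝[>] 0) atTop :=
    Real.tendsto_log_atTop.comp hy
  set ℓ := -Real.log M.A with hℓ
  set b := -Real.log M.B with hb
  set k := -Real.log κ with hk
  have hℓ0 : 0 < ℓ := neg_pos.2 (Real.log_neg M.A_pos M.A_lt_one)
  have hb0 : 0 < b := neg_pos.2 (Real.log_neg M.B_pos M.B_lt_one)
  have hk0 : 0 < k := neg_pos.2 (Real.log_neg hκ hκ₁)
  have e₁ := (hH.atTop_mul_atTop₀ hu).eventually_ge_atTop (2 * k + 1)
  have e₂ := ((tendsto_atTop_add_const_right _ (-(c * ℓ)) hH).atTop_mul_atTop₀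
    hu).eventually_ge_atTop (c * ℓ * (Real.log 2 - Real.log b) + 2 * k)
  have e₃ := hy.eventually_ge_atTop k
  have e₄ : ∀ᶠ R in 𝓝[>] (0 : ℝ), R ∈ Ioo 0 (κ * M.A ^ n₀) :=
    Ioo_mem_nhdsGT (mul_pos hκ (pow_pos M.A_pos _))
  obtain ⟨ε, hε0, hε⟩ := mem_nhdsGT_iff_exists_Ioo_subset.1
    (hΦH.and (e₁.and (e₂.and (e₃.and e₄))))
  have hε0 : 0 < ε := hε0
  refine ⟨min ε κ / 2, by positivity, by linarith [min_le_right ε κ], ?_⟩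
  intro r R hr hrR hR hRC i n m hn₁ hn₂ hm
  obtain ⟨hΦR, e₁, e₂, e₃, e₄⟩ := hε ⟨hR, by linarith [min_le_left ε κ, lt_min hε0 hκ]⟩
  have hR1 : R < 1 := by linarith [min_le_right ε κ]
  have hlogR : Real.log R < 0 := Real.log_neg hR hR1
  have habs : |Real.log R| = -Real.log R := abs_of_neg hlogR
  rw [habs] at hΦR e₁ e₂ e₃
  set u := Real.log (-Real.log R) with hu'
  -- The restriction on `r`, with `Φ R = H R * log |log R| / |log R|`.
  have hlogr : Real.log r < Real.log R - H R * u := by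
    have h := Real.log_lt_log hr hrR
    rw [Real.log_rpow hR, hΦR] at h
    have : (1 + H R * (u / -Real.log R)) * Real.log R = Real.log R - H R * u := by
      have := hlogR.ne
      field_simp
      ring
    linarith
  have hlm : Real.log (M.len ω i m) ≤ Real.log r + k := by
    have := Real.log_le_log (len_pos m) hm
    rw [Real.log_div hr.ne' hκ.ne'] at this
    linarith
  have hln : Real.log R - k ≤ Real.log (M.len ω i n) := by
    have := Real.log_le_log (mul_pos hκ hR) hn₁
    rw [Real.log_mul hκ.ne' hR.ne'] at this
    linarith
  have hgap : H R * u - 2 * k ≤ Real.log (M.len ω i n) - Real.log (M.len ω i m) := by linarith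
  have hnm : n ≤ m := by
    by_contra! hlt
    have := Real.log_le_log (len_pos n) (len_antitone (M := M) (ω := ω) (i := i) hlt.le)
    linarith
  have hn₀ : n₀ < n := by
    have h : M.A ^ n < M.A ^ n₀ := by
      refine (A_pow_le_len (ω := ω) (i := i) n).trans_lt (hn₂.trans_lt ?_)
      rw [div_lt_iff₀' hκ]
      exact e₄.2
    exact (pow_lt_pow_iff_right_of_lt_one₀ M.A_pos M.A_lt_one).1 h
  refine ⟨hn₀.le, hnm, ?_⟩
  have hn0 : (0 : ℝ) < n := by exact_mod_cast (Nat.zero_le n₀).trans_lt hn₀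
  -- One step multiplies the length by at least `A`, which bounds `m - n` from below by a multiple
  -- of `H R * log |log R|`, and by at most `B`, which bounds `log n` by `log |log R| + O(1)`.
  have hsteps : Real.log (M.len ω i n) - Real.log (M.len ω i m) ≤ ((m : ℝ) - n) * ℓ := by
    have h := Real.log_le_log (mul_pos (pow_pos M.A_pos _) (len_pos n))
      (A_pow_mul_len_le (ω := ω) (i := i) hnm)
    rw [Real.log_mul (pow_pos M.A_pos _).ne' (len_pos n).ne', Real.log_pow,
      Nat.cast_sub hnm] at h
    linarith
  have hlogn : Real.log n ≤ u + (Real.log 2 - Real.log b) := by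
    have h := Real.log_le_log (len_pos n) (len_le_B_pow (ω := ω) (i := i) n)
    rw [Real.log_pow] at h
    have h2 : (n : ℝ) * b ≤ 2 * -Real.log R := by linarith
    have h3 := Real.log_le_log (mul_pos hn0 hb0) h2
    rw [Real.log_mul hn0.ne' hb0.ne', Real.log_mul two_ne_zero (neg_pos.2 hlogR).ne'] at h3
    linarith
  have hfin : c * Real.log n * ℓ ≤ ((m : ℝ) - n) * ℓ := by
    have h := mul_le_mul_of_nonneg_left hlogn (mul_nonneg hc hℓ0.le)
    linarith
  exact le_of_mul_le_mul_right hfin hℓ0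

/-- If over every long window the measures of Moran intervals decrease no faster than the `d`-th
powers of the lengths, then `d` is admissible for the upper `Φ`-dimension. -/
theorem upperPhiDim_le_of_windows {Φ : ℝ → ℝ} (hΦ : IsLarge Φ) {d c : ℝ} (hd : 0 ≤ d)
    (hc : 0 ≤ c) {n₀ : ℕ} (hp : ∀ k j, 0 < M.p j (ω k).2)
    (hwin : ∀ n m : ℕ, n₀ ≤ n → n ≤ m → c * Real.log n ≤ (m : ℝ) - n → ∀ i : ℕ → Fin M.K,
      ∑ k ∈ Finset.Ico n m, M.gain d (i k) (ω k) ≤ 0) :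
    upperPhiDim Φ (M.moranMeasure ω) ≤ d := by
  have hκ : 0 < M.A * M.τ := mul_pos M.A_pos M.τ_pos
  have hκA : M.A * M.τ < M.A := mul_lt_of_lt_one_right M.A_pos M.τ_lt_one
  have hκτ : M.A * M.τ < M.τ := mul_lt_of_lt_one_left M.τ_pos M.A_lt_one
  obtain ⟨C₁, hC0, hC1, hC⟩ := exists_scale hΦ hc hκ (hκA.trans M.A_lt_one) n₀ ω
  set κ := M.A * M.τ with hκdef
  refine sInf_le ⟨d, rfl, C₁, ((1 / κ) ^ 2) ^ d, hC0, by linarith [M.τ_lt_one], by positivity, ?_⟩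
  intro r R hr hrR hRR hRC x hx
  have hR : 0 < R := hr.trans (hrR.trans_le hRR)
  have hrR' : r < R := hrR.trans_le hRR
  obtain ⟨i, rfl⟩ := support_subset_range_coding hx
  -- The larger ball meets the Moran set inside step `n`, the smaller one contains the piece of
  -- step `m + 1`; both lengths are within a factor `κ` of the radii.
  obtain ⟨n, hn₁, hn₂⟩ := exists_len ω i (div_pos hR M.τ_pos)
    ((div_le_one M.τ_pos).2 (by linarith))
  obtain ⟨m, hm₁, hm₂⟩ := exists_len ω i hr (by linarith [M.τ_lt_one])
  have hAn := (A_mul_len_le (M := M) (ω := ω) (i := i) n).trans hn₂.le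
  have hAm := (mul_le_mul_of_nonneg_left hm₁ M.A_pos.le).trans
    (A_mul_len_le (M := M) (ω := ω) (i := i) m)
  rw [div_le_iff₀ M.τ_pos] at hn₁
  have hup : M.len ω i n ≤ R / κ := by
    rw [le_div_iff₀ M.τ_pos] at hAn
    rw [le_div_iff₀ hκ]
    linarith
  obtain ⟨h0, hnm, hL⟩ := hC r R hr hrR hR hRC i n (m + 1)
    (by nlinarith [len_pos (M := M) (ω := ω) (i := i) n, M.τ_lt_one, M.A_lt_one, M.τ_pos, M.A_pos])
    hup
    (by rw [le_div_iff₀ hκ]; nlinarith [len_pos (M := M) (ω := ω) (i := i) (m + 1), M.A_lt_one])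
  have hw := hwin n (m + 1) h0 hnm hL i
  rw [sum_Ico_gain hp d hnm, sub_nonpos, Real.log_le_log_iff
    (div_pos (mass_pos hp _) (mass_pos hp _))
    (Real.rpow_pos_of_pos (div_pos (len_pos _) (len_pos _)) _)] at hw
  calc _ ≤ M.mass ω i n / M.mass ω i (m + 1) :=
        div_le_div₀ (mass_pos hp n).le (ball_le_mass (by linarith)) (mass_pos hp _)
          (mass_le_ball hm₂)
    _ ≤ (M.len ω i n / M.len ω i (m + 1)) ^ d := hw
    _ ≤ ((1 / κ) ^ 2 * (R / r)) ^ d := by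
        refine Real.rpow_le_rpow (div_pos (len_pos _) (len_pos _)).le ?_ hd
        rw [div_le_iff₀ (len_pos _)]
        calc M.len ω i n ≤ R / κ := hup
          _ = (1 / κ) ^ 2 * (R / r) * (κ * r) := by field_simp
          _ ≤ _ := mul_le_mul_of_nonneg_left (by nlinarith) (by positivity)
    _ = _ := Real.mul_rpow (by positivity) (by positivity)

/-- If over every long window the measures of Moran intervals decrease at least as fast as the
`d`-th powers of the lengths, then `d` is admissible for the lower `Φ`-dimension. -/
theorem le_lowerPhiDim_of_windows {Φ : ℝ → ℝ} (hΦ : IsLarge Φ) {d c : ℝ} (hd : 0 ≤ d)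
    (hc : 0 ≤ c) {n₀ : ℕ} (hp : ∀ k j, 0 < M.p j (ω k).2)
    (hwin : ∀ n m : ℕ, n₀ ≤ n → n ≤ m → c * Real.log n ≤ (m : ℝ) - n → ∀ i : ℕ → Fin M.K,
      0 ≤ ∑ k ∈ Finset.Ico n m, M.gain d (i k) (ω k)) :
    d ≤ lowerPhiDim Φ (M.moranMeasure ω) := by
  have hκ : 0 < M.A * M.τ := mul_pos M.A_pos M.τ_pos
  have hκA : M.A * M.τ < M.A := mul_lt_of_lt_one_right M.A_pos M.τ_lt_one
  have hκτ : M.A * M.τ < M.τ := mul_lt_of_lt_one_left M.τ_pos M.A_lt_one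
  obtain ⟨C₁, hC0, hC1, hC⟩ := exists_scale hΦ hc hκ (hκA.trans M.A_lt_one) n₀ ω
  set κ := M.A * M.τ with hκdef
  refine le_sSup ⟨d, rfl, C₁, (κ ^ 2) ^ d, hC0, by linarith [M.τ_lt_one], by positivity, ?_⟩
  intro r R hr hrR hRR hRC x hx
  have hR : 0 < R := hr.trans (hrR.trans_le hRR)
  have hrR' : r < R := hrR.trans_le hRR
  obtain ⟨i, rfl⟩ := support_subset_range_coding hx
  -- The larger ball contains the piece of step `n + 1`, the smaller one meets the Moran set
  -- inside step `m`.
  obtain ⟨n, hn₁, hn₂⟩ := exists_len ω i hR (by linarith [M.τ_lt_one])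
  obtain ⟨m, hm₁, hm₂⟩ := exists_len ω i (div_pos hr M.τ_pos)
    ((div_le_one M.τ_pos).2 (by linarith))
  have hAn := (mul_le_mul_of_nonneg_left hn₁ M.A_pos.le).trans
    (A_mul_len_le (M := M) (ω := ω) (i := i) n)
  have hAm := (A_mul_len_le (M := M) (ω := ω) (i := i) m).trans hm₂.le
  rw [div_le_iff₀ M.τ_pos] at hm₁
  have hup : M.len ω i m ≤ r / κ := by
    rw [le_div_iff₀ M.τ_pos] at hAm
    rw [le_div_iff₀ hκ]
    linarith
  have hlow : κ * R ≤ M.len ω i (n + 1) := by nlinarith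
  obtain ⟨h0, hnm, hL⟩ := hC r R hr hrR hR hRC i (n + 1) m hlow
    (by rw [le_div_iff₀ hκ]; nlinarith [len_pos (M := M) (ω := ω) (i := i) (n + 1), M.A_lt_one])
    hup
  have hw := hwin (n + 1) m h0 hnm hL i
  rw [sum_Ico_gain hp d hnm, sub_nonneg, Real.log_le_log_iff
    (Real.rpow_pos_of_pos (div_pos (len_pos _) (len_pos _)) _)
    (div_pos (mass_pos hp _) (mass_pos hp _))] at hw
  calc (κ ^ 2) ^ d * (R / r) ^ d = (κ ^ 2 * (R / r)) ^ d :=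
        (Real.mul_rpow (by positivity) (by positivity)).symm
    _ ≤ (M.len ω i (n + 1) / M.len ω i m) ^ d := by
        refine Real.rpow_le_rpow (by positivity) ?_ hd
        rw [le_div_iff₀ (len_pos _)]
        calc κ ^ 2 * (R / r) * M.len ω i m ≤ κ ^ 2 * (R / r) * (r / κ) :=
              mul_le_mul_of_nonneg_left hup (by positivity)
          _ = κ * R := by field_simp
          _ ≤ _ := hlow
    _ ≤ M.mass ω i (n + 1) / M.mass ω i m := hw
    _ ≤ _ := div_le_div₀ measureReal_nonneg (mass_le_ball hn₂) (ball_real_pos hp hr)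
        (ball_le_mass (by linarith))

end Model

end RandomMoran

/-! ### Single points of extremal local growth -/

namespace RandomMoran

/-- Every `R` in `(0, 1)` is an admissible outer radius in the definition of the
`Φ`-dimensions. -/
theorem IsDimensionFunction.rpow_le {Φ : ℝ → ℝ} (hΦ : IsDimensionFunction Φ) {R : ℝ} (h₀ : 0 < R)
    (h₁ : R < 1) : R ^ (1 + Φ R) ≤ R := by
  have h := Real.rpow_le_rpow_of_exponent_ge h₀ h₁.le
    (le_add_of_nonneg_right (a := (1 : ℝ)) (hΦ.nonneg R ⟨h₀, h₁⟩))
  rwa [Real.rpow_one] at h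

namespace Model

variable {𝒜 𝒲 : Type*} [MeasurableSpace 𝒜] [MeasurableSpace 𝒲] {M : Model 𝒜 𝒲}
  {ω : ℕ → 𝒜 × 𝒲} {i : ℕ → Fin M.K}

/-- Along the address `i` the measures of the Moran intervals become arbitrarily small compared with
the `d`-th powers of the lengths, which the point with address `i` detects for a fixed `R`. -/
theorem le_upperPhiDim_of_tendsto {Φ : ℝ → ℝ} (hΦ : IsDimensionFunction Φ) {d : ℝ}
    (hp : ∀ k j, 0 < M.p j (ω k).2)
    (h : Tendsto (fun n => ∑ k ∈ Finset.range n, M.gain d (i k) (ω k)) atTop atTop) :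
    d ≤ upperPhiDim Φ (M.moranMeasure ω) := by
  refine le_sInf ?_
  rintro _ ⟨d', rfl, C₁, C₂, hC0, hC1, hC2, hC⟩
  rw [EReal.coe_le_coe_iff]
  by_contra! hlt
  have hle := hΦ.rpow_le hC0 hC1
  have hT : 0 < C₁ ^ (1 + Φ C₁) := Real.rpow_pos_of_pos hC0 _
  set b := (M.moranMeasure ω).real (Metric.ball (M.coding ω i) C₁) with hb
  have hb0 : 0 < b := ball_real_pos hp hC0
  obtain ⟨n, hn₁, hn₂⟩ := ((h.eventually_gt_atTop
    (Real.log C₂ + d * Real.log (C₁ / M.τ) - Real.log b)).and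
    ((tendsto_len (M := M) (ω := ω) (i := i)).eventually_lt_const hT)).exists
  have hl := len_pos (M := M) (ω := ω) (i := i) n
  have hr : 0 < M.τ * M.len ω i n := mul_pos M.τ_pos hl
  have hrT : M.τ * M.len ω i n < C₁ ^ (1 + Φ C₁) :=
    (mul_le_of_le_one_left hl.le M.τ_lt_one.le).trans_lt hn₂
  have hrC := hrT.trans_le hle
  have hm := mass_pos (i := i) hp n
  have key : b / M.mass ω i n ≤ C₂ * (C₁ / (M.τ * M.len ω i n)) ^ d := by
    refine (div_le_div_of_nonneg_left hb0.le (ball_real_pos hp hr) (ball_le_mass le_rfl)).trans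
      ((hC _ C₁ hr hrT hle le_rfl _ (coding_mem_support hp)).trans ?_)
    exact mul_le_mul_of_nonneg_left
      (Real.rpow_le_rpow_of_exponent_le ((one_le_div hr).2 hrC.le) hlt.le) hC2.le
  have hlog := Real.log_le_log (div_pos hb0 hm) key
  rw [Real.log_div hb0.ne' hm.ne', Real.log_mul hC2.ne'
    (Real.rpow_pos_of_pos (div_pos hC0 hr) _).ne', Real.log_rpow (div_pos hC0 hr),
    ← div_div, Real.log_div (div_pos hC0 M.τ_pos).ne' hl.ne'] at hlog
  rw [sum_gain hp] at hn₁
  linarith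

/-- Along the address `i` the measures of the Moran intervals become arbitrarily large compared with
the `d`-th powers of the lengths, which the point with address `i` detects for a fixed `R`. -/
theorem lowerPhiDim_le_of_tendsto {Φ : ℝ → ℝ} (hΦ : IsDimensionFunction Φ) {d : ℝ}
    (hp : ∀ k j, 0 < M.p j (ω k).2)
    (h : Tendsto (fun n => ∑ k ∈ Finset.range n, -M.gain d (i k) (ω k)) atTop atTop) :
    lowerPhiDim Φ (M.moranMeasure ω) ≤ d := by
  refine sSup_le ?_
  rintro _ ⟨d', rfl, C₁, C₂, hC0, hC1, hC2, hC⟩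
  rw [EReal.coe_le_coe_iff]
  by_contra! hlt
  have hle := hΦ.rpow_le hC0 hC1
  have hT : 0 < C₁ ^ (1 + Φ C₁) / 2 := half_pos (Real.rpow_pos_of_pos hC0 _)
  obtain ⟨n, hn₁, hn₂⟩ := ((h.eventually_gt_atTop (-(Real.log C₂ + d * Real.log (C₁ / 2)))).and
    ((tendsto_len (M := M) (ω := ω) (i := i)).eventually_lt_const hT)).exists
  have hl := len_pos (M := M) (ω := ω) (i := i) n
  have hr : 0 < 2 * M.len ω i n := mul_pos two_pos hl
  have hrT : 2 * M.len ω i n < C₁ ^ (1 + Φ C₁) := by linarith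
  have hrC := hrT.trans_le hle
  have hm := mass_pos (i := i) hp n
  have key : C₂ * (C₁ / (2 * M.len ω i n)) ^ d ≤ 1 / M.mass ω i n := by
    refine le_trans ?_ ((hC _ C₁ hr hrT hle le_rfl _ (coding_mem_support (i := i) hp)).trans
      (div_le_div₀ zero_le_one measureReal_le_one hm (mass_le_ball (by linarith))))
    exact mul_le_mul_of_nonneg_left
      (Real.rpow_le_rpow_of_exponent_le ((one_le_div hr).2 hrC.le) hlt.le) hC2.le
  have hpow := Real.rpow_pos_of_pos (div_pos hC0 hr) d
  have hlog := Real.log_le_log (mul_pos hC2 hpow) key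
  rw [Real.log_mul hC2.ne' hpow.ne', Real.log_rpow (div_pos hC0 hr), one_div, Real.log_inv,
    ← div_div, Real.log_div (half_pos hC0).ne' hl.ne'] at hlog
  rw [Finset.sum_neg_distrib, sum_gain hp] at hn₁
  linarith

/-- Balls increase with the radius, so nonpositive exponents are admissible. -/
theorem le_lowerPhiDim_of_nonpos (Φ : ℝ → ℝ) {d : ℝ} (hd : d ≤ 0)
    (hp : ∀ k j, 0 < M.p j (ω k).2) : d ≤ lowerPhiDim Φ (M.moranMeasure ω) := by
  refine le_sSup ⟨d, rfl, 1 / 2, 1, by norm_num, by norm_num, one_pos, ?_⟩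
  intro r R hr hrR hRR _ x hx
  obtain ⟨i, rfl⟩ := support_subset_range_coding hx
  have hrR' : r ≤ R := (hrR.trans_le hRR).le
  rw [one_mul]
  exact (Real.rpow_le_one_of_one_le_of_nonpos ((one_le_div hr).2 hrR') hd).trans
    ((one_le_div (ball_real_pos hp hr)).2 (measureReal_mono (Metric.ball_subset_ball hrR')))

/-! ### Almost sure comparison with a fixed exponent -/

section Almost

variable {P : Measure (𝒜 × 𝒲)} [IsProbabilityMeasure P] {Φ : ℝ → ℝ} {d : ℝ}

theorem ae_le_upperPhiDim (hP : M.MomentCondition P) (hΦ : IsDimensionFunction Φ) {θ : ℝ}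
    (h : d < M.G P θ) : ∀ᵐ ω ∂(Measure.infinitePi (fun _ : ℕ => P)),
      d ≤ upperPhiDim Φ (M.moranMeasure ω) := by
  have hs := M.measurable_m θ
  filter_upwards [M.ae_forall_p_pos hP, ae_tendsto_sum_atTop (M.measurable_gain d hs)
    (M.integrable_gain hP d hs) (M.integral_gain_pos hP hs h)] with ω hp hω
  exact le_upperPhiDim_of_tendsto (i := fun k => M.m θ (ω k)) hΦ hp hω

theorem ae_lowerPhiDim_le (hP : M.MomentCondition P) (hΦ : IsDimensionFunction Φ) {θ : ℝ}
    (h : M.G' P θ < d) : ∀ᵐ ω ∂(Measure.infinitePi (fun _ : ℕ => P)),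
      lowerPhiDim Φ (M.moranMeasure ω) ≤ d := by
  have hs := M.measurable_m' θ
  have hneg := M.integral_gain_neg hP hs h
  filter_upwards [M.ae_forall_p_pos hP, ae_tendsto_sum_atTop (M.measurable_gain d hs).neg
    (M.integrable_gain hP d hs).neg (by simpa [integral_neg] using hneg)] with ω hp hω
  exact lowerPhiDim_le_of_tendsto (i := fun k => M.m' θ (ω k)) hΦ hp hω

theorem ae_upperPhiDim_le (hP : M.MomentCondition P) (hΦ : IsLarge Φ) (hd : 0 ≤ d)
    (h : M.G P d < d) : ∀ᵐ ω ∂(Measure.infinitePi (fun _ : ℕ => P)),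
      upperPhiDim Φ (M.moranMeasure ω) ≤ d := by
  have hs := M.measurable_m d
  obtain ⟨t, ht, h₁, h₂⟩ := M.integrable_exp_gain hP d hs
  obtain ⟨c, hc, hae⟩ := ae_window_sums_nonpos (M.measurable_gain d hs) ht h₁ h₂
    (M.integral_gain_neg hP hs h)
  filter_upwards [M.ae_forall_p_pos hP, hae] with ω hp hω
  obtain ⟨n₀, hn₀⟩ := hω
  refine upperPhiDim_le_of_windows (n₀ := n₀) hΦ hd hc hp fun n m hn hnm hL i => ?_
  exact (Finset.sum_le_sum fun k _ => M.gain_le_gain_m (hp k) (i k)).trans (hn₀ n m hn hnm hL)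

/-- For `d < 0` no condition on `G'` is needed, see `le_lowerPhiDim_of_nonpos`. -/
theorem ae_le_lowerPhiDim (hP : M.MomentCondition P) (hΦ : IsLarge Φ)
    (h : 0 ≤ d → d < M.G' P d) : ∀ᵐ ω ∂(Measure.infinitePi (fun _ : ℕ => P)),
      d ≤ lowerPhiDim Φ (M.moranMeasure ω) := by
  rcases le_total d 0 with hd | hd
  · filter_upwards [M.ae_forall_p_pos hP] with ω hp using le_lowerPhiDim_of_nonpos Φ hd hp
  have hs := M.measurable_m' d
  obtain ⟨t, ht, h₁, h₂⟩ := M.integrable_exp_gain hP d hs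
  have hpos := M.integral_gain_pos hP hs (h hd)
  obtain ⟨c, hc, hae⟩ := ae_window_sums_nonpos (M.measurable_gain d hs).neg ht
    (by simpa using h₂) (by simpa using h₁) (by simpa [integral_neg] using hpos)
  filter_upwards [M.ae_forall_p_pos hP, hae] with ω hp hω
  obtain ⟨n₀, hn₀⟩ := hω
  refine le_lowerPhiDim_of_windows (n₀ := n₀) hΦ hd hc hp fun n m hn hnm hL i => ?_
  have h := hn₀ n m hn hnm hL
  simp only [Pi.neg_apply, Finset.sum_neg_distrib, Left.neg_nonpos_iff] at h
  exact h.trans (Finset.sum_le_sum fun k _ => M.gain_m'_le_gain (hp k) (i k))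

end Almost

end Model

end RandomMoran

theorem mainTheorem7 {𝒜 𝒲 : Type*} [MeasurableSpace 𝒜] [MeasurableSpace 𝒲]
    (M : RandomMoran.Model 𝒜 𝒲)
    (P : MeasureTheory.Measure (𝒜 × 𝒲)) [MeasureTheory.IsProbabilityMeasure P]
    (hP : M.MomentCondition P)
    (Φ : ℝ → ℝ) (hΦ : RandomMoran.IsDimensionFunction Φ) (hlarge : RandomMoran.IsLarge Φ) :
    ∀ᵐ ω ∂(MeasureTheory.Measure.infinitePi (fun _ : ℕ => P)),
      RandomMoran.upperPhiDim Φ (M.moranMeasure ω) =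
          (⨆ θ : Set.Ici (0 : ℝ), ((M.G P θ : ℝ) : EReal)) ∧
        RandomMoran.lowerPhiDim Φ (M.moranMeasure ω) =
          (⨅ θ : Set.Ici (0 : ℝ), ((M.G' P θ : ℝ) : EReal)) := by
  -- Comparing with rational exponents only keeps the exceptional set null.
  have hu₁ : ∀ᵐ ω ∂(Measure.infinitePi (fun _ : ℕ => P)), ∀ q : ℚ,
      (((q : ℝ) : EReal) < ⨆ θ : Ici (0 : ℝ), ((M.G P θ : ℝ) : EReal)) →
        ((q : ℝ) : EReal) ≤ RandomMoran.upperPhiDim Φ (M.moranMeasure ω) := by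
    refine ae_all_iff.2 fun q => eventually_imp_distrib_left.2 fun hq => ?_
    obtain ⟨θ, hθ⟩ := lt_iSup_iff.1 hq
    exact RandomMoran.Model.ae_le_upperPhiDim hP hΦ (EReal.coe_lt_coe_iff.1 hθ)
  have hu₂ : ∀ᵐ ω ∂(Measure.infinitePi (fun _ : ℕ => P)), ∀ q : ℚ,
      ((⨆ θ : Ici (0 : ℝ), ((M.G P θ : ℝ) : EReal)) < ((q : ℝ) : EReal)) →
        RandomMoran.upperPhiDim Φ (M.moranMeasure ω) ≤ ((q : ℝ) : EReal) := by
    refine ae_all_iff.2 fun q => eventually_imp_distrib_left.2 fun hq => ?_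
    have hG : ∀ θ : ℝ, 0 ≤ θ → M.G P θ < q := fun θ hθ =>
      EReal.coe_lt_coe_iff.1 ((le_iSup (fun θ : Ici (0 : ℝ) => ((M.G P θ : ℝ) : EReal))
        ⟨θ, hθ⟩).trans_lt hq)
    have hq0 : (0 : ℝ) ≤ q := (M.G_nonneg P 0).trans (hG 0 le_rfl).le
    exact RandomMoran.Model.ae_upperPhiDim_le hP hlarge hq0 (hG q hq0)
  have hl₁ : ∀ᵐ ω ∂(Measure.infinitePi (fun _ : ℕ => P)), ∀ q : ℚ,
      ((⨅ θ : Ici (0 : ℝ), ((M.G' P θ : ℝ) : EReal)) < ((q : ℝ) : EReal)) →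
        RandomMoran.lowerPhiDim Φ (M.moranMeasure ω) ≤ ((q : ℝ) : EReal) := by
    refine ae_all_iff.2 fun q => eventually_imp_distrib_left.2 fun hq => ?_
    obtain ⟨θ, hθ⟩ := iInf_lt_iff.1 hq
    exact RandomMoran.Model.ae_lowerPhiDim_le hP hΦ (EReal.coe_lt_coe_iff.1 hθ)
  have hl₂ : ∀ᵐ ω ∂(Measure.infinitePi (fun _ : ℕ => P)), ∀ q : ℚ,
      (((q : ℝ) : EReal) < ⨅ θ : Ici (0 : ℝ), ((M.G' P θ : ℝ) : EReal)) →
        ((q : ℝ) : EReal) ≤ RandomMoran.lowerPhiDim Φ (M.moranMeasure ω) := by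
    refine ae_all_iff.2 fun q => eventually_imp_distrib_left.2 fun hq => ?_
    refine RandomMoran.Model.ae_le_lowerPhiDim hP hlarge fun hq0 => ?_
    exact EReal.coe_lt_coe_iff.1 (hq.trans_le
      (iInf_le (fun θ : Ici (0 : ℝ) => ((M.G' P θ : ℝ) : EReal)) ⟨q, hq0⟩))
  filter_upwards [hu₁, hu₂, hl₁, hl₂] with ω hu₁ hu₂ hl₁ hl₂
  refine ⟨le_antisymm ?_ ?_, le_antisymm ?_ ?_⟩ <;> by_contra! hlt <;>
    obtain ⟨q, hq₁, hq₂⟩ := EReal.lt_iff_exists_rat_btwn.1 hlt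
  · exact hq₂.not_ge (hu₂ q hq₁)
  · exact hq₁.not_ge (hu₁ q hq₂)
  · exact hq₂.not_ge (hl₁ q hq₁)
  · exact hq₁.not_ge (hl₂ q hq₂)
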